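/- A lattice polytope is the convex hull of a non-empty finite set of points of $\mathbb{R}^d$ with integer coordinates; it is a lattice $(d,k)$-polytope if all of its vertices belong to $\{0,1,\dots,k\}^d$ (it need not be full-dimensional). The graph of a polytope $P$ has the vertices of $P$ as its vertices, two of them being adjacent when the segment between them is an edge of $P$; $d(u,v)$ denotes the distance of two vertices $u$ and $v$ in the graph of $P$, and the diameter of $P$ is the diameter of its graph. Let $\delta(d,k)$ be the largest possible diameter of a lattice $(d,k)$-polytope. Theorem. Assume that $d\geq 3$ and $k\geq 3$. If $u$ and $v$ are two vertices of a lattice $(d,k)$-polytope $P$, then there is a path from $u$ to $v$ in the graph of $P$, and at least one of the following inequalities holds: (i) $d(u,v)\leq\delta(d-1,k)+k-1$, (ii) $d(u,v)\leq\delta(d-2,k)+2k-2$, (iii) $d(u,v)\leq\delta(d-3,k)+3k-2$. -/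

import Mathlib

/-- A lattice polytope in `ℝ^d`: the convex hull of a non-empty finite set of points with integer
coordinates. -/
def IsLatticePolytope {d : ℕ} (P : Set (Fin d → ℝ)) : Prop :=
  ∃ S : Set (Fin d → ℝ), S.Finite ∧ S.Nonempty ∧
    (∀ x ∈ S, ∀ i, ∃ m : ℤ, x i = (m : ℝ)) ∧ P = convexHull ℝ S

/-- The vertices of a polytope are its extreme points. -/
abbrev polytopeVertices {d : ℕ} (P : Set (Fin d → ℝ)) : Set (Fin d → ℝ) :=
  Set.extremePoints ℝ P

/-- A lattice `(d,k)`-polytope: a lattice polytope all of whose vertices belong to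
`{0, 1, ..., k}^d`. It is not required to be full-dimensional. -/
def IsLatticeDKPolytope (d k : ℕ) (P : Set (Fin d → ℝ)) : Prop :=
  IsLatticePolytope P ∧
    ∀ x ∈ polytopeVertices P, ∀ i, ∃ m : ℕ, m ≤ k ∧ x i = (m : ℝ)

/-- The graph of a polytope `P`: two distinct vertices are adjacent when the segment between them
is a face (that is, an edge) of `P`. -/
def polytopeGraph {d : ℕ} (P : Set (Fin d → ℝ)) : SimpleGraph (polytopeVertices P) where
  Adj u v := u ≠ v ∧ IsExtreme ℝ P (segment ℝ (u : Fin d → ℝ) (v : Fin d → ℝ))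
  symm := ⟨fun u v h => ⟨h.1.symm, by rw [segment_symm]; exact h.2⟩⟩
  loopless := ⟨fun _ h => h.1 rfl⟩

/-- `δ(d,k)`: the largest diameter of the graph of a lattice `(d,k)`-polytope. -/
noncomputable def maxLatticeDiameter (d k : ℕ) : ℕ :=
  sSup {n : ℕ | ∃ P : Set (Fin d → ℝ), IsLatticeDKPolytope d k P ∧ n = (polytopeGraph P).diam}

/-!
Suppose that the distance `D` of `u` and `v` exceeds all three bounds. Faces on which one, two or
three coordinates are constant are lattice polytopes in dimension `d - 1`, `d - 2` or `d - 3`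
(`IsLatticeDKPolytope.dist_le_of_face`), and an integer-valued linear function can be decreased along
the edges by at least one in each step, until it is minimal (`exists_edge_lt`,
`VertexModel.exists_descent`). So if a face of the cube with codimension `t ≤ 3` contains a vertex of
`P`, then `D` is at most `δ(d-t,k)` plus the total distance of `u` and `v` to the `t` facets of the
cube that form this face.

For `t = 1` this gives `u + v = (k, …, k)`, a vertex on each facet of the cube, and no path from `u`
or `v` that approaches a facet by more than its length (`Far.off_add_off`, `Far.facet_tight`). For
`t = 2` and `t = 3`, paths from `u` and `v` can together gain only one unit. If a path from `u` gains
this unit towards a ridge, all other descents are rigid (`Far.shortcut`): the path from `v`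
to the ridge stays in a plane parallel to two axes and proceeds by the smallest possible steps, and
convexity in this plane forces `v` to be within one unit of both facets that form the ridge
(`off_le_one_of_first_step`).

Hence `u` and `v` reach any given facet parallel to the axis, except in a configuration that requires
`k = 3` (`Far.axial_or_skew`): if they drift in opposite directions, then both are within one unit of
the facet and `k ≤ 2`. When a coordinate of `u` is strictly between `0` and `k`, this puts `u` between
two other vertices, or puts one of `u` and `v` in a triangle of other vertices in the exceptional
configuration. When `u` is a vertex of the cube, its neighbor on a path to the opposite facet lies
between `u` and another vertex (`VertexModel.not_far`).
-/

/-! ### Integer coordinates of vertices and descents along edges -/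

/-- An integer-valued function on `V` that is affine in the coordinates `a`. -/
def IsAffineInCoords {d : ℕ} {V : Type*} (a : V → Fin d → ℤ) (h : V → ℤ) : Prop :=
  ∃ (c : Fin d → ℤ) (b : ℤ), ∀ x, h x = b + ∑ i, c i * a x i

/-- The properties of the graph and of the integer vertex coordinates of a lattice
`(d,k)`-polytope on which the distance estimate rests; `δ t` bounds the distance of two vertices of
a face on which `t` coordinates are constant. Such a face is given as the set of minimizers of an
affine function. The last two fields express, with integer weights, that vertices are extreme
points and that edges are extreme sets. -/
structure VertexModel (d : ℕ) (k : ℤ) (δ : ℕ → ℤ) (V : Type*) where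
  /-- the graph of the polytope -/
  graph : SimpleGraph V
  connected : graph.Connected
  /-- the integer coordinates of a vertex -/
  coord : V → Fin d → ℤ
  coord_nonneg : ∀ x i, 0 ≤ coord x i
  coord_le : ∀ x i, coord x i ≤ k
  exists_adj_lt : ∀ h, IsAffineInCoords coord h → ∀ x y, h y < h x →
    ∃ z, graph.Adj x z ∧ h z < h x
  dist_le_of_face : ∀ h, IsAffineInCoords coord h → ∀ (T : Finset (Fin d)) (x y : V),
    (∀ z, h x ≤ h z) → h y = h x → (∀ z, h z = h x → ∀ t ∈ T, coord z t = coord x t) →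
    (graph.dist x y : ℤ) ≤ δ T.card
  eq_of_barycenter : ∀ (x y₁ y₂ y₃ : V) (m₁ m₂ m₃ : ℤ), 0 < m₁ → 0 ≤ m₂ → 0 ≤ m₃ →
    (∀ i, m₁ * (coord y₁ i - coord x i) + m₂ * (coord y₂ i - coord x i)
      + m₃ * (coord y₃ i - coord x i) = 0) → y₁ = x
  eq_of_crossing : ∀ (x x' y z : V) (n₁ n₂ m₁ m₂ : ℤ), graph.Adj x x' → 0 ≤ n₁ → 0 ≤ n₂ →
    0 < m₁ → 0 < m₂ → m₁ + m₂ = n₁ + n₂ →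
    (∀ i, m₁ * coord y i + m₂ * coord z i = n₁ * coord x i + n₂ * coord x' i) → y = x ∨ y = x'

namespace VertexModel

variable {d : ℕ} {k : ℤ} {δ : ℕ → ℤ} {V : Type*} (M : VertexModel d k δ V)

/-- The lattice distance from `x` to the facet `x_i = k` (for `s = true`) or `x_i = 0` (for
`s = false`) of the cube. -/
def off (i : Fin d) (s : Bool) (x : V) : ℤ := if s then k - M.coord x i else M.coord x i

/-- The graph distance as an integer. -/
noncomputable def zdist (x y : V) : ℤ := M.graph.dist x y

lemma off_nonneg (i : Fin d) (s : Bool) (x : V) : 0 ≤ M.off i s x := by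
  have := M.coord_nonneg x i; have := M.coord_le x i
  unfold off; split <;> omega

lemma off_not (i : Fin d) (s : Bool) (x : V) : M.off i (!s) x = k - M.off i s x := by
  cases s <;> simp [off]

lemma off_le (i : Fin d) (s : Bool) (x : V) : M.off i s x ≤ k := by
  have := M.off_nonneg i (!s) x
  rw [off_not] at this; omega

lemma coord_eq_iff_off_eq (i : Fin d) (s : Bool) {x y : V} :
    M.coord x i = M.coord y i ↔ M.off i s x = M.off i s y := by
  cases s <;> simp [off]

lemma isAffine_off (i : Fin d) (s : Bool) : IsAffineInCoords M.coord (M.off i s) := by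
  cases s
  · exact ⟨Pi.single i 1, 0, fun x => by simp [off, Pi.single_apply]⟩
  · exact ⟨Pi.single i (-1), k, fun x => by simp [off, Pi.single_apply, sub_eq_add_neg]⟩

end VertexModel

lemma IsAffineInCoords.add {d : ℕ} {V : Type*} {a : V → Fin d → ℤ} {f g : V → ℤ}
    (hf : IsAffineInCoords a f) (hg : IsAffineInCoords a g) :
    IsAffineInCoords a (fun x => f x + g x) := by
  obtain ⟨c, b, h⟩ := hf
  obtain ⟨c', b', h'⟩ := hg
  refine ⟨c + c', b + b', fun x => ?_⟩
  simp only [h, h', Pi.add_apply, add_mul, Finset.sum_add_distrib]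
  ring

lemma IsAffineInCoords.const_mul {d : ℕ} {V : Type*} {a : V → Fin d → ℤ} {f : V → ℤ}
    (m : ℤ) (hf : IsAffineInCoords a f) : IsAffineInCoords a (fun x => m * f x) := by
  obtain ⟨c, b, h⟩ := hf
  refine ⟨fun i => m * c i, m * b, fun x => ?_⟩
  simp only [h, mul_add, Finset.mul_sum, mul_assoc]

namespace VertexModel

variable {d : ℕ} {k : ℤ} {δ : ℕ → ℤ} {V : Type*} (M : VertexModel d k δ V)

lemma zdist_self (x : V) : M.zdist x x = 0 := by simp [zdist]

lemma zdist_comm (x y : V) : M.zdist x y = M.zdist y x := by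
  simp [zdist, SimpleGraph.dist_comm]

lemma zdist_triangle (x y z : V) : M.zdist x z ≤ M.zdist x y + M.zdist y z := by
  unfold zdist; exact_mod_cast M.connected.dist_triangle

lemma zdist_of_adj {x y : V} (h : M.graph.Adj x y) : M.zdist x y = 1 := by
  simp [zdist, SimpleGraph.dist_eq_one_iff_adj.2 h]

/-- Walking down an affine function: each edge lowers it by at least one, so a minimizer is reached
within as many edges as the total decrease. -/
lemma exists_descent {h : V → ℤ} (hh : IsAffineInCoords M.coord h) {z : V}
    (hz : ∀ y, h z ≤ h y) (x : V) : ∃ y, h y = h z ∧ M.zdist x y ≤ h x - h z := by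
  obtain ⟨n, hn⟩ : ∃ n : ℕ, h x - h z ≤ n := ⟨(h x - h z).toNat, by omega⟩
  induction n generalizing x with
  | zero =>
    have := hz x
    exact ⟨x, by push_cast at hn; omega, by rw [zdist_self]; omega⟩
  | succ n ih =>
    by_cases hx : h z < h x
    · obtain ⟨x', hadj, hlt⟩ := M.exists_adj_lt h hh x z hx
      obtain ⟨y, hy, hd⟩ := ih x' (by push_cast at hn; omega)
      have := M.zdist_triangle x x' y
      rw [M.zdist_of_adj hadj] at this
      exact ⟨y, hy, by omega⟩
    · have := hz x
      exact ⟨x, by omega, by rw [zdist_self]; omega⟩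

/-- Two vertices can be joined by descending to the face where `h` is minimal, and travelling
there. -/
lemma zdist_le_of_descent {h : V → ℤ} (hh : IsAffineInCoords M.coord h) {z : V}
    (hz : ∀ y, h z ≤ h y) (T : Finset (Fin d))
    (hT : ∀ y, h y = h z → ∀ t ∈ T, M.coord y t = M.coord z t) (x y : V) :
    M.zdist x y ≤ (h x - h z) + (h y - h z) + δ T.card := by
  obtain ⟨x', hx', hdx⟩ := M.exists_descent hh hz x
  obtain ⟨y', hy', hdy⟩ := M.exists_descent hh hz y
  have h1 := M.zdist_triangle x x' y
  have h2 := M.zdist_triangle x' y' y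
  rw [M.zdist_comm y' y] at h2
  have h3 : M.zdist x' y' ≤ δ T.card := by
    refine M.dist_le_of_face h hh T x' y' (fun w => hx' ▸ hz w) (hy'.trans hx'.symm) ?_
    intro w hw t ht
    rw [hT w (hw.trans hx') t ht, hT x' hx' t ht]
  omega

/-- Among the vertices with a property, one minimizes a given nonnegative function. -/
lemma exists_minimal (p : V → Prop) (hp : ∃ z, p z) (f : V → ℤ) (hf : ∀ x, 0 ≤ f x) :
    ∃ z, p z ∧ ∀ y, p y → f z ≤ f y := by
  obtain ⟨m, ⟨z, hz, rfl⟩, hm⟩ := Int.exists_least_of_bdd (P := fun m => ∃ z, p z ∧ f z = m)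
    ⟨0, by rintro _ ⟨z, _, rfl⟩; exact hf z⟩ (hp.imp' f fun z hz => ⟨z, hz, rfl⟩)
  exact ⟨z, hz, fun y hy => hm _ ⟨y, hy, rfl⟩⟩

/-- The vertices on one facet of the cube. -/
def OnFacet (i : Fin d) (s : Bool) (x : V) : Prop := M.off i s x = 0

/-- The vertices on the intersection of two facets of the cube, for `i ≠ j`. -/
def OnRidge (i j : Fin d) (s t : Bool) (x : V) : Prop := M.off i s x = 0 ∧ M.off j t x = 0

/-- The sum of the distances to two facets of the cube. -/
def off₂ (i j : Fin d) (s t : Bool) (x : V) : ℤ := M.off i s x + M.off j t x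

lemma isAffine_off₂ (i j : Fin d) (s t : Bool) : IsAffineInCoords M.coord (M.off₂ i j s t) :=
  (M.isAffine_off i s).add (M.isAffine_off j t)

lemma off₂_nonneg (i j : Fin d) (s t : Bool) (x : V) : 0 ≤ M.off₂ i j s t x :=
  add_nonneg (M.off_nonneg i s x) (M.off_nonneg j t x)

lemma off₂_comm (i j : Fin d) (s t : Bool) (x : V) : M.off₂ j i t s x = M.off₂ i j s t x :=
  add_comm _ _

lemma off₂_eq_zero {i j : Fin d} {s t : Bool} {x : V} :
    M.off₂ i j s t x = 0 ↔ M.OnRidge i j s t x := by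
  have := M.off_nonneg i s x; have := M.off_nonneg j t x
  unfold off₂ OnRidge; omega

section bounds

/-- The facet `(i, s)` of the cube is replaced by the parallel hyperplane that supports the polytope
at `z`. -/
lemma zdist_le_facet (i : Fin d) (s : Bool) {z : V} (hz : ∀ y, M.off i s z ≤ M.off i s y)
    (x y : V) : M.zdist x y ≤ M.off i s x + M.off i s y - 2 * M.off i s z + δ 1 := by
  have := M.zdist_le_of_descent (M.isAffine_off i s) hz {i}
    (by intro y hy t ht; rw [Finset.mem_singleton.1 ht]
        exact (M.coord_eq_iff_off_eq i s).2 hy) x y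
  simp only [Finset.card_singleton] at this
  omega

lemma zdist_le_ridge {i j : Fin d} (hij : i ≠ j) {s t : Bool} {z : V}
    (hz : M.OnRidge i j s t z) (x y : V) :
    M.zdist x y ≤ M.off₂ i j s t x + M.off₂ i j s t y + δ 2 := by
  have hz0 := M.off₂_eq_zero.2 hz
  have := M.zdist_le_of_descent (M.isAffine_off₂ i j s t) (z := z)
    (fun y => by rw [hz0]; exact M.off₂_nonneg ..) {i, j}
    (by
      intro y hy w hw
      have hy' := M.off₂_eq_zero.1 (hy.trans hz0)
      rcases Finset.mem_insert.1 hw with rfl | hw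
      · exact (M.coord_eq_iff_off_eq w s).2 (hy'.1.trans hz.1.symm)
      · rw [Finset.mem_singleton.1 hw]
        exact (M.coord_eq_iff_off_eq j t).2 (hy'.2.trans hz.2.symm)) x y
  rw [Finset.card_pair hij] at this
  omega

lemma card_triple {i j l : Fin d} (hij : i ≠ j) (hil : i ≠ l) (hjl : j ≠ l) :
    ({i, j, l} : Finset (Fin d)).card = 3 := by
  rw [Finset.card_insert_of_notMem (by simp [hij, hil]), Finset.card_pair hjl]

lemma zdist_le_corner {i j l : Fin d} (hij : i ≠ j) (hil : i ≠ l) (hjl : j ≠ l)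
    {s t r : Bool} {z : V} (hz : M.OnRidge i j s t z) (hz' : M.OnFacet l r z) (x y : V) :
    M.zdist x y ≤ (M.off₂ i j s t x + M.off l r x) + (M.off₂ i j s t y + M.off l r y) + δ 3 := by
  have hz0 := M.off₂_eq_zero.2 hz
  have hz0' : M.off l r z = 0 := hz'
  have := M.zdist_le_of_descent ((M.isAffine_off₂ i j s t).add (M.isAffine_off l r)) (z := z)
    (fun y => by
      rw [hz0, hz0']; exact add_nonneg (M.off₂_nonneg ..) (M.off_nonneg ..)) {i, j, l}
    (by
      intro y hy w hw
      have h1 := M.off₂_nonneg i j s t y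
      have h2 := M.off_nonneg l r y
      have hy' := M.off₂_eq_zero.1 (show M.off₂ i j s t y = 0 by omega)
      rcases Finset.mem_insert.1 hw with rfl | hw
      · exact (M.coord_eq_iff_off_eq w s).2 (hy'.1.trans hz.1.symm)
      rcases Finset.mem_insert.1 hw with rfl | hw
      · exact (M.coord_eq_iff_off_eq w t).2 (hy'.2.trans hz.2.symm)
      · rw [Finset.mem_singleton.1 hw]
        exact (M.coord_eq_iff_off_eq l r).2 (by omega)) x y
  rw [card_triple hij hil hjl] at this
  omega

/-- Minimizing `(k + 1) f + g` amounts to minimizing `f` first and `g` second when the values of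
`g` lie between `0` and `k`. -/
lemma lex_le {f g : V → ℤ} {z : V} (hf : ∀ y, 0 ≤ f y) (hg : ∀ y, 0 ≤ g y)
    (hgk : ∀ y, g y ≤ k) (hz : f z = 0) (hmin : ∀ y, f y = 0 → g z ≤ g y) (y : V) :
    (k + 1) * f z + g z ≤ (k + 1) * f y + g y := by
  have h0 := hf y; have h1 := hg y; have h2 := hgk z; have h3 := hg z
  rcases h0.eq_or_lt with h | h
  · rw [hz, ← h]; linarith [hmin y h.symm]
  · rw [hz]; nlinarith

lemma lex_eq {f g : V → ℤ} {z : V} (hf : ∀ y, 0 ≤ f y) (hg : ∀ y, 0 ≤ g y)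
    (hgk : ∀ y, g y ≤ k) (hz : f z = 0) {y : V}
    (h : (k + 1) * f y + g y = (k + 1) * f z + g z) : f y = 0 ∧ g y = g z := by
  have h0 := hf y; have h1 := hg y; have h2 := hgk z; have h3 := hg z
  rcases h0.eq_or_lt with h' | h'
  · exact ⟨h'.symm, by rw [hz, ← h'] at h; linarith⟩
  · rw [hz] at h; nlinarith

/-- Two vertices on a facet of the cube can be joined inside it through the face where the
`j`-th coordinate is extremal on that facet. -/
lemma zdist_le_in_facet {i j : Fin d} (hij : i ≠ j) {s t : Bool} {z : V}
    (hz : M.OnFacet i s z) (hmin : ∀ y, M.OnFacet i s y → M.off j t z ≤ M.off j t y)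
    {x y : V} (hx : M.OnFacet i s x) (hy : M.OnFacet i s y) :
    M.zdist x y ≤ M.off j t x + M.off j t y - 2 * M.off j t z + δ 2 := by
  have hf := M.off_nonneg i s
  have hg := M.off_nonneg j t
  have hgk := M.off_le j t
  have := M.zdist_le_of_descent (((M.isAffine_off i s).const_mul (k + 1)).add (M.isAffine_off j t))
    (lex_le hf hg hgk hz hmin) {i, j}
    (by
      intro y hy w hw
      obtain ⟨h1, h2⟩ := lex_eq hf hg hgk hz hy
      rcases Finset.mem_insert.1 hw with rfl | hw
      · exact (M.coord_eq_iff_off_eq w s).2 (h1.trans hz.symm)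
      · rw [Finset.mem_singleton.1 hw]
        exact (M.coord_eq_iff_off_eq j t).2 h2) x y
  rw [Finset.card_pair hij] at this
  unfold OnFacet at hx hy hz
  rw [hx, hy, hz] at this
  linarith

lemma zdist_le_in_ridge {i j l : Fin d} (hij : i ≠ j) (hil : i ≠ l) (hjl : j ≠ l)
    {s t r : Bool} {z : V} (hz : M.OnRidge i j s t z)
    (hmin : ∀ y, M.OnRidge i j s t y → M.off l r z ≤ M.off l r y)
    {x y : V} (hx : M.OnRidge i j s t x) (hy : M.OnRidge i j s t y) :
    M.zdist x y ≤ M.off l r x + M.off l r y - 2 * M.off l r z + δ 3 := by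
  have hf := M.off₂_nonneg i j s t
  have hg := M.off_nonneg l r
  have hgk := M.off_le l r
  have hz0 := M.off₂_eq_zero.2 hz
  have := M.zdist_le_of_descent
    (((M.isAffine_off₂ i j s t).const_mul (k + 1)).add (M.isAffine_off l r))
    (lex_le hf hg hgk hz0 (fun y hy => hmin y (M.off₂_eq_zero.1 hy))) {i, j, l}
    (by
      intro y hy w hw
      obtain ⟨h1, h2⟩ := lex_eq hf hg hgk hz0 hy
      have h1 := M.off₂_eq_zero.1 h1
      rcases Finset.mem_insert.1 hw with rfl | hw
      · exact (M.coord_eq_iff_off_eq w s).2 (h1.1.trans hz.1.symm)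
      rcases Finset.mem_insert.1 hw with rfl | hw
      · exact (M.coord_eq_iff_off_eq w t).2 (h1.2.trans hz.2.symm)
      · rw [Finset.mem_singleton.1 hw]
        exact (M.coord_eq_iff_off_eq l r).2 h2) x y
  rw [card_triple hij hil hjl, M.off₂_eq_zero.2 hx, M.off₂_eq_zero.2 hy, hz0] at this
  linarith

end bounds

lemma exists_descent_facet {i : Fin d} {s : Bool} {z : V} (hz : M.OnFacet i s z) (x : V) :
    ∃ y, M.OnFacet i s y ∧ M.zdist x y ≤ M.off i s x := by
  have hz' : M.off i s z = 0 := hz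
  obtain ⟨y, hy, hd⟩ := M.exists_descent (M.isAffine_off i s) (z := z)
    (fun y => by rw [hz']; exact M.off_nonneg ..) x
  exact ⟨y, hy.trans hz', by omega⟩

lemma exists_descent_ridge {i j : Fin d} {s t : Bool} {z : V} (hz : M.OnRidge i j s t z) (x : V) :
    ∃ y, M.OnRidge i j s t y ∧ M.zdist x y ≤ M.off₂ i j s t x := by
  have hz' := M.off₂_eq_zero.2 hz
  obtain ⟨y, hy, hd⟩ := M.exists_descent (M.isAffine_off₂ i j s t) (z := z)
    (fun y => by rw [hz']; exact M.off₂_nonneg ..) x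
  exact ⟨y, M.off₂_eq_zero.1 (hy.trans hz'), by omega⟩

/-- `x` and `y` differ at most in the coordinates `i` and `j`. -/
def SamePlane (i j : Fin d) (x y : V) : Prop :=
  ∀ l, l ≠ i → l ≠ j → M.coord x l = M.coord y l

variable {M} in
lemma SamePlane.symm {i j : Fin d} {x y : V} (h : M.SamePlane i j x y) : M.SamePlane i j y x :=
  fun l hi hj => (h l hi hj).symm

variable {M} in
lemma SamePlane.trans {i j : Fin d} {x y z : V} (h : M.SamePlane i j x y)
    (h' : M.SamePlane i j y z) : M.SamePlane i j x z :=
  fun l hi hj => (h l hi hj).trans (h' l hi hj)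

variable {M} in
lemma SamePlane.swap {i j : Fin d} {x y : V} (h : M.SamePlane i j x y) : M.SamePlane j i x y :=
  fun l hj hi => h l hi hj

/-! ### Descents in a coordinate plane -/

/-- A vertex is not a nontrivial barycenter of three vertices of a common coordinate plane. -/
lemma eq_of_planar_barycenter {i j : Fin d} (s t : Bool) {x y₁ y₂ y₃ : V} (h₁ : M.SamePlane i j y₁ x)
    (h₂ : M.SamePlane i j y₂ x) (h₃ : M.SamePlane i j y₃ x) {m₁ m₂ m₃ : ℤ} (hm₁ : 0 < m₁)
    (hm₂ : 0 ≤ m₂) (hm₃ : 0 ≤ m₃)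
    (hi : m₁ * (M.off i s y₁ - M.off i s x) + m₂ * (M.off i s y₂ - M.off i s x)
      + m₃ * (M.off i s y₃ - M.off i s x) = 0)
    (hj : m₁ * (M.off j t y₁ - M.off j t x) + m₂ * (M.off j t y₂ - M.off j t x)
      + m₃ * (M.off j t y₃ - M.off j t x) = 0) : y₁ = x := by
  refine M.eq_of_barycenter x y₁ y₂ y₃ m₁ m₂ m₃ hm₁ hm₂ hm₃ fun l => ?_
  by_cases hli : l = i
  · subst hli
    cases s <;> simp only [off, if_true, if_false, Bool.false_eq_true] at hi <;> linarith
  by_cases hlj : l = j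
  · subst hlj
    cases t <;> simp only [off, if_true, if_false, Bool.false_eq_true] at hj <;> linarith
  rw [h₁ l hli hlj, h₂ l hli hlj, h₃ l hli hlj]; ring

/-- A segment between two vertices of a coordinate plane that crosses an edge in that plane starts
at an end of this edge. -/
lemma eq_of_planar_crossing {i j : Fin d} (s t : Bool) {x x' y z : V} (hadj : M.graph.Adj x x')
    (h₁ : M.SamePlane i j x' x) (h₂ : M.SamePlane i j y x) (h₃ : M.SamePlane i j z x)
    {n₁ n₂ m₁ m₂ : ℤ} (hn₁ : 0 ≤ n₁) (hn₂ : 0 ≤ n₂) (hm₁ : 0 < m₁) (hm₂ : 0 < m₂)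
    (hmn : m₁ + m₂ = n₁ + n₂)
    (hi : m₁ * M.off i s y + m₂ * M.off i s z = n₁ * M.off i s x + n₂ * M.off i s x')
    (hj : m₁ * M.off j t y + m₂ * M.off j t z = n₁ * M.off j t x + n₂ * M.off j t x') :
    y = x ∨ y = x' := by
  refine M.eq_of_crossing x x' y z n₁ n₂ m₁ m₂ hadj hn₁ hn₂ hm₁ hm₂ hmn fun l => ?_
  have hm : m₁ = n₁ + n₂ - m₂ := by omega
  subst hm
  by_cases hli : l = i
  · subst hli
    cases s <;> simp only [off, if_true, if_false, Bool.false_eq_true] at hi <;> linarith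
  by_cases hlj : l = j
  · subst hlj
    cases t <;> simp only [off, if_true, if_false, Bool.false_eq_true] at hj <;> linarith
  rw [h₁ l hli hlj, h₂ l hli hlj, h₃ l hli hlj]; ring

/-- Suppose that no descent from `v` towards a ridge of the cube is shorter than required, that the
shortest ones stay in the coordinate plane of `v`, and that one of them starts with a unit step in
the direction `i`. Then `v` is within one unit of both facets that form the ridge.

In the plane, put the origin at `v`, so that the point `c` of the ridge is `(p, q)`. The first two
steps of the descent lead to `y₁ = (1, 0)` and to `y₂ = (1 + a, 1 - a)`. If `p` or `q` exceeds one,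
then `y₁` or `y₂` lies in the convex hull of other vertices, or the edge from `y₁` to `y₂` crosses
the segment from `v` to `c`. -/
lemma off_le_one_of_first_step {i j : Fin d} {s t : Bool} {v y₁ c : V}
    (htight : ∀ y, M.off₂ i j s t v - M.off₂ i j s t y ≤ M.zdist v y)
    (hplane : ∀ y, M.zdist v y ≤ M.off₂ i j s t v - M.off₂ i j s t y → M.SamePlane i j y v)
    (hc : M.OnRidge i j s t c) (hcv : M.SamePlane i j c v)
    (hy₁ : M.graph.Adj v y₁) (hi : M.off i s y₁ = M.off i s v - 1)
    (hj : M.off j t y₁ = M.off j t v) :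
    M.off i s v ≤ 1 ∧ M.off j t v ≤ 1 := by
  obtain ⟨hci, hcj⟩ := hc
  have hp1 : 1 ≤ M.off i s v := by have := M.off_nonneg i s y₁; omega
  have hq0 := M.off_nonneg j t v
  set p := M.off i s v with hp
  set q := M.off j t v with hq
  have hne : v ≠ y₁ := hy₁.ne
  have hd₁ := M.zdist_of_adj hy₁
  have hy₁v : M.SamePlane i j y₁ v := hplane y₁ (by rw [hd₁]; unfold off₂; omega)
  by_contra hcon
  have hpq : 2 ≤ p ∨ 2 ≤ q := by omega
  by_cases hq1 : q = 0
  -- `y₁` lies between `v` and `c`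
  · refine hne (M.eq_of_planar_barycenter s t (m₁ := p - 1) (m₂ := 1) (m₃ := 0) (y₂ := c) (y₃ := v)
      hy₁v.symm (hcv.trans hy₁v.symm) hy₁v.symm (by omega) (by omega) (by omega) ?_ ?_)
    · rw [hi, hci, ← hp]; ring
    · rw [hj, hcj, ← hq, hq1]; ring
  obtain ⟨y₂, hadj₂, hlt⟩ := M.exists_adj_lt _ (M.isAffine_off₂ i j s t) y₁ c (by
    rw [M.off₂_eq_zero.2 ⟨hci, hcj⟩]; unfold off₂; omega)
  have hd₂ : M.zdist v y₂ ≤ 2 := by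
    have := M.zdist_triangle v y₁ y₂
    rw [hd₁, M.zdist_of_adj hadj₂] at this; omega
  have h1 := htight y₂
  have hy₂v : M.SamePlane i j y₂ v := hplane y₂ (by unfold off₂ at *; omega)
  obtain ⟨a, ha⟩ : ∃ a, M.off i s y₂ = p - 1 - a := ⟨p - 1 - M.off i s y₂, by ring⟩
  have hb : M.off j t y₂ = q - 1 + a := by unfold off₂ at *; omega
  have hne₂ : y₂ ≠ y₁ := hadj₂.ne.symm
  have hvy₂ : v ≠ y₂ := by
    rintro rfl
    have := hp ▸ ha; have := hq ▸ hb; omega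
  rcases le_or_gt 1 a with ha1 | ha1
  -- `y₁` lies in the triangle spanned by `v`, `y₂` and `c`
  · refine hne₂ (M.eq_of_planar_barycenter s t (m₁ := q) (m₂ := a - 1)
      (m₃ := a * q + (a - 1) * (p - 1)) (y₂ := c) (y₃ := v)
      (hy₂v.trans hy₁v.symm) (hcv.trans hy₁v.symm) hy₁v.symm (by omega) (by omega) ?_ ?_ ?_)
    · exact add_nonneg (mul_nonneg (by omega) hq0) (mul_nonneg (by omega) (by omega))
    · rw [hi, ha, hci, ← hp]; ring
    · rw [hj, hb, hcj, ← hq]; ring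
  obtain ⟨b, rfl⟩ : ∃ b, a = -b := ⟨-a, by ring⟩
  have hb0 : 0 ≤ b := by omega
  by_cases hcase : 1 ≤ b ∨ q ≤ p
  -- the edge from `y₁` to `y₂` crosses the segment from `v` to `c`
  · have hn₁ : 0 ≤ p - q + b * (p + q) := by
      rcases hcase with h | h
      · nlinarith
      · have : 0 ≤ b * (p + q) := mul_nonneg hb0 (by omega)
        omega
    have hm₁ : 0 < p - 1 + b * (p + q - 1) := by
      rcases hcase with h | h
      · have : 0 < b * (p + q - 1) := mul_pos (by omega) (by omega)
        omega
      · have : 0 ≤ b * (p + q - 1) := mul_nonneg hb0 (by omega)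
        omega
    rcases M.eq_of_planar_crossing s t (n₁ := p - q + b * (p + q)) (n₂ := q)
      (m₁ := p - 1 + b * (p + q - 1)) (m₂ := 1 + b) (y := v) (z := c) hadj₂
      (hy₂v.trans hy₁v.symm) hy₁v.symm (hcv.trans hy₁v.symm) hn₁ hq0 hm₁ (by omega) (by ring)
      (by rw [hi, ha, hci, ← hp]; ring) (by rw [hj, hb, hcj, ← hq]; ring) with h | h
    · exact hne h
    · exact hvy₂ h
  -- `y₂ = (1, 1)` lies in the triangle spanned by `v`, `y₁` and `c`
  · obtain rfl : b = 0 := by omega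
    have hcy : c = y₂ := M.eq_of_planar_barycenter s t (m₁ := 1) (m₂ := q - p) (m₃ := p - 1)
      (y₂ := y₁) (y₃ := v) (hcv.trans hy₂v.symm) (hy₁v.trans hy₂v.symm) hy₂v.symm (by omega)
      (by omega) (by omega) (by rw [hi, ha, hci, ← hp]; ring) (by rw [hj, hb, hcj, ← hq]; ring)
    rw [← hcy, hci] at ha
    rw [← hcy, hcj] at hb
    omega

/-- If no descent from `v` towards a facet, or towards the ridge formed by two facets, is shorter
than required, and the shortest ones towards the ridge stay in the coordinate plane of `v`, then `v`
is within one unit of both facets: the first step of the descent is a unit vector. -/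
lemma off_le_one_of_tight {i j : Fin d} {s t : Bool} {v c : V}
    (htight : ∀ y, M.off₂ i j s t v - M.off₂ i j s t y ≤ M.zdist v y)
    (hplane : ∀ y, M.zdist v y ≤ M.off₂ i j s t v - M.off₂ i j s t y → M.SamePlane i j y v)
    (hi : ∀ y, M.off i s v - M.off i s y ≤ M.zdist v y)
    (hj : ∀ y, M.off j t v - M.off j t y ≤ M.zdist v y)
    (hc : M.OnRidge i j s t c) (hcv : M.SamePlane i j c v) :
    M.off i s v ≤ 1 ∧ M.off j t v ≤ 1 := by
  have hp0 := M.off_nonneg i s v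
  have hq0 := M.off_nonneg j t v
  by_cases h0 : M.off₂ i j s t v = 0
  · unfold off₂ at h0; omega
  have h0' := M.off₂_nonneg i j s t v
  obtain ⟨y, hadj, hlt⟩ := M.exists_adj_lt _ (M.isAffine_off₂ i j s t) v c (by
    rw [M.off₂_eq_zero.2 hc]; omega)
  have hd := M.zdist_of_adj hadj
  have h1 := htight y
  have h2 := hi y
  have h3 := hj y
  rw [hd] at h1 h2 h3
  by_cases hy : M.off i s y = M.off i s v
  · refine (M.off_le_one_of_first_step (i := j) (j := i) (s := t) (t := s) (y₁ := y) (c := c)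
      (fun y => ?_) (fun y hy => ?_) hc.symm hcv.swap hadj ?_ hy).symm
    · rw [M.off₂_comm i j s t v, M.off₂_comm i j s t y]; exact htight y
    · rw [M.off₂_comm i j s t v, M.off₂_comm i j s t y] at hy; exact (hplane y hy).swap
    · unfold off₂ at *; omega
  · exact M.off_le_one_of_first_step htight hplane hc hcv hadj (by unfold off₂ at *; omega)
      (by unfold off₂ at *; omega)

/-! ### Pairs of vertices at large distance -/

/-- The pairs of vertices whose distance exceeds each of the three bounds `δ 1 + k - 1`,
`δ 2 + 2k - 2` and `δ 3 + 3k - 2`. -/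
structure Far (u v : V) : Prop where
  facet : δ 1 + k ≤ M.zdist u v
  ridge : δ 2 + 2 * k - 1 ≤ M.zdist u v
  corner : δ 3 + 3 * k - 1 ≤ M.zdist u v

variable {M}

lemma Far.symm {u v : V} (h : M.Far u v) : M.Far v u := by
  obtain ⟨h1, h2, h3⟩ := h
  rw [M.zdist_comm] at h1 h2 h3
  exact ⟨h1, h2, h3⟩

/-- A far pair is symmetric about the center of the cube, and each facet of the cube contains a
vertex. -/
lemma Far.off_add_off {u v : V} (h : M.Far u v) (i : Fin d) (s : Bool) :
    M.off i s u + M.off i s v = k ∧ ∃ z, M.OnFacet i s z := by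
  have key : ∀ s, ∃ z, 2 * M.off i s z ≤ M.off i s u + M.off i s v - k := by
    intro s
    obtain ⟨z, -, hz⟩ := exists_minimal (fun _ : V => True) ⟨u, trivial⟩ _ (M.off_nonneg i s)
    have := M.zdist_le_facet i s (fun y => hz y trivial) u v
    have := h.facet
    exact ⟨z, by omega⟩
  obtain ⟨z, hz⟩ := key s
  obtain ⟨z', hz'⟩ := key !s
  have h1 := M.off_nonneg i s z
  have h2 := M.off_nonneg i (!s) z'
  rw [M.off_not i s u, M.off_not i s v] at hz'
  exact ⟨by omega, z, show M.off i s z = 0 by omega⟩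

/-- No path from `u` approaches a facet of the cube by more than its length. -/
lemma Far.facet_tight {u v : V} (h : M.Far u v) (i : Fin d) (s : Bool) (x : V) :
    M.off i s u - M.off i s x ≤ M.zdist u x := by
  obtain ⟨hsum, z, hz⟩ := h.off_add_off i s
  have hz : M.off i s z = 0 := hz
  have h1 := M.zdist_le_facet i s (z := z) (fun y => by rw [hz]; exact M.off_nonneg ..) x v
  have h2 := M.zdist_triangle u x v
  have := h.facet
  omega

/-- For ridges that contain a vertex, paths from `u` and from `v` can together gain at most one more
than their total length. -/
lemma Far.ridge_tight {u v : V} (h : M.Far u v) {i j : Fin d} (hij : i ≠ j) {s t : Bool} {z : V}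
    (hz : M.OnRidge i j s t z) (x y : V) :
    (M.off₂ i j s t u - M.off₂ i j s t x) + (M.off₂ i j s t v - M.off₂ i j s t y) - 1
      ≤ M.zdist u x + M.zdist v y := by
  have h1 := M.zdist_le_ridge hij hz x y
  have h2 := M.zdist_triangle u x v
  have h3 := M.zdist_triangle x y v
  rw [M.zdist_comm y v] at h3
  have h4 := (h.off_add_off i s).1
  have h5 := (h.off_add_off j t).1
  have := h.ridge
  unfold off₂ at *
  omega

/-- The analogue of `Far.ridge_tight` for the intersection of three facets of the cube. -/
lemma Far.corner_tight {u v : V} (h : M.Far u v) {i j l : Fin d} (hij : i ≠ j) (hil : i ≠ l)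
    (hjl : j ≠ l) {s t r : Bool} {z : V} (hz : M.OnRidge i j s t z) (hz' : M.OnFacet l r z)
    (x y : V) :
    (M.off₂ i j s t u + M.off l r u - M.off₂ i j s t x - M.off l r x)
      + (M.off₂ i j s t v + M.off l r v - M.off₂ i j s t y - M.off l r y) - 1
      ≤ M.zdist u x + M.zdist v y := by
  have h1 := M.zdist_le_corner hij hil hjl hz hz' x y
  have h2 := M.zdist_triangle u x v
  have h3 := M.zdist_triangle x y v
  rw [M.zdist_comm y v] at h3
  have h4 := (h.off_add_off i s).1
  have h5 := (h.off_add_off j t).1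
  have h6 := (h.off_add_off l r).1
  have := h.corner
  unfold off₂ at *
  omega

/-- What follows when a path from `u` approaches the ridge by one more than its length: this uses up
the only unit that the bounds for the ridge and for the corners on it leave. So no path from `v` can
do the same, and neither the paths from `u` that do so nor the shortest descents from `v` can change
any of the other coordinates. -/
structure Shortcut (M : VertexModel d k δ V) (u v : V) (i j : Fin d) (s t : Bool) : Prop where
  short_plane : ∀ x, M.zdist u x ≤ M.off₂ i j s t u - M.off₂ i j s t x - 1 → M.SamePlane i j x u
  short_tight : ∀ x, M.off₂ i j s t u - M.off₂ i j s t x - 1 ≤ M.zdist u x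
  other_plane : ∀ y, M.zdist v y ≤ M.off₂ i j s t v - M.off₂ i j s t y → M.SamePlane i j y v
  other_tight : ∀ y, M.off₂ i j s t v - M.off₂ i j s t y ≤ M.zdist v y
  short_ridge : ∃ c, M.OnRidge i j s t c ∧ M.SamePlane i j c u
  other_off : M.off i s v ≤ 1 ∧ M.off j t v ≤ 1

/-- A path from `u` that approaches a ridge by more than its length provides a shortcut, because every
corner on that ridge carries a vertex. -/
lemma Far.shortcut {u v : V} (h : M.Far u v) {i j : Fin d} (hij : i ≠ j) {s t : Bool} {z : V}
    (hz : M.OnRidge i j s t z) {x : V}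
    (hx : M.zdist u x ≤ M.off₂ i j s t u - M.off₂ i j s t x - 1) :
    M.Shortcut u v i j s t := by
  have htightv : ∀ y, M.off₂ i j s t v - M.off₂ i j s t y ≤ M.zdist v y := fun y => by
    have := h.ridge_tight hij hz x y; omega
  have htightu : ∀ x, M.off₂ i j s t u - M.off₂ i j s t x - 1 ≤ M.zdist u x := fun x => by
    have := h.ridge_tight hij hz x v
    rw [M.zdist_self] at this; omega
  obtain ⟨c, hc, hxc⟩ := M.exists_descent_ridge hz x
  obtain ⟨e, he, hve⟩ := M.exists_descent_ridge hz v
  have hc0 := M.off₂_eq_zero.2 hc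
  have he0 := M.off₂_eq_zero.2 he
  have huc : M.zdist u c ≤ M.off₂ i j s t u - 1 := by
    have := M.zdist_triangle u x c; omega
  have hsum : M.off₂ i j s t u + M.off₂ i j s t v = 2 * k := by
    have := (h.off_add_off i s).1
    have := (h.off_add_off j t).1
    unfold off₂; omega
  -- every corner on the ridge carries a vertex
  have hcorner : ∀ l, i ≠ l → j ≠ l → ∀ r, ∃ w, M.OnRidge i j s t w ∧ M.OnFacet l r w := by
    intro l hil hjl r
    have key : ∀ r, ∃ w, M.OnRidge i j s t w ∧
        2 * M.off l r w ≤ M.off l r c + M.off l r e - k := by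
      intro r
      obtain ⟨w, hw, hmin⟩ := exists_minimal (M.OnRidge i j s t) ⟨z, hz⟩ _ (M.off_nonneg l r)
      have h1 := M.zdist_le_in_ridge hij hil hjl hw hmin hc he
      have h2 := M.zdist_triangle u c v
      have h3 := M.zdist_triangle c e v
      rw [M.zdist_comm e v] at h3
      have := h.corner
      exact ⟨w, hw, by omega⟩
    obtain ⟨w, hw, hw1⟩ := key r
    obtain ⟨w', -, hw2⟩ := key !r
    have h1 := M.off_nonneg l r w
    have h2 := M.off_nonneg l (!r) w'
    rw [M.off_not l r c, M.off_not l r e] at hw2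
    exact ⟨w, hw, show M.off l r w = 0 by omega⟩
  have hplaneu : ∀ x, M.zdist u x ≤ M.off₂ i j s t u - M.off₂ i j s t x - 1 →
      M.SamePlane i j x u := by
    intro x hx l hli hlj
    have key : ∀ r, M.off l r u ≤ M.off l r x := by
      intro r
      obtain ⟨w, hw, hw'⟩ := hcorner l hli.symm hlj.symm r
      have := h.corner_tight hij hli.symm hlj.symm hw hw' x v
      rw [M.zdist_self] at this
      omega
    have h1 := key true
    have h2 := key false
    simp only [off, if_true, if_false, Bool.false_eq_true] at h1 h2
    omega
  have hplanev : ∀ y, M.zdist v y ≤ M.off₂ i j s t v - M.off₂ i j s t y →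
      M.SamePlane i j y v := by
    intro y hy l hli hlj
    have hxl := hplaneu x hx l hli hlj
    have key : ∀ r, M.off l r v ≤ M.off l r y := by
      intro r
      obtain ⟨w, hw, hw'⟩ := hcorner l hli.symm hlj.symm r
      have := h.corner_tight hij hli.symm hlj.symm hw hw' x y
      have := (M.coord_eq_iff_off_eq l r).1 hxl
      omega
    have h1 := key true
    have h2 := key false
    simp only [off, if_true, if_false, Bool.false_eq_true] at h1 h2
    omega
  refine ⟨hplaneu, htightu, hplanev, htightv, ⟨c, hc, hplaneu c (by omega)⟩, ?_⟩
  exact M.off_le_one_of_tight htightv hplanev (h.symm.facet_tight i s) (h.symm.facet_tight j t) he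
    (hplanev e (by omega))

end VertexModel

/-! ### Descents to the facets of the cube -/

namespace VertexModel

variable {d : ℕ} {k : ℤ} {δ : ℕ → ℤ} {V : Type*} {M : VertexModel d k δ V}

/-- `x` is the projection of `u` along the `i`-th axis to the facet `(i, s)` of the cube. -/
def IsAxialProj (M : VertexModel d k δ V) (i : Fin d) (s : Bool) (u x : V) : Prop :=
  M.OnFacet i s x ∧ ∀ l, l ≠ i → M.coord x l = M.coord u l

lemma IsAxialProj.samePlane {i : Fin d} {s : Bool} {u x : V} (h : M.IsAxialProj i s u x) :
    M.SamePlane i i x u := fun l hl _ => h.2 l hl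

/-- The exceptional configuration, which requires `k = 3`: `n` is near to the ridge, within one unit
of both of its facets, and moves to the facet `(i, s)` parallel to the axis, while the
projection of `f` to the ridge parallel to the plane of the two coordinates is a vertex. -/
structure Skew (M : VertexModel d k δ V) (n f : V) (i j : Fin d) (s t : Bool) : Prop where
  off_left : M.off i s n ≤ 1
  off_right : M.off j t n = 1
  proj : ∃ x, M.IsAxialProj i s n x
  ridge : ∃ c, M.OnRidge i j s t c ∧ M.SamePlane i j c f

/-- If the descents from `u` to `x` and from `v` to `y` towards the facet `(i, s)` together also gain
one unit towards the facet `(j, t)`, then the pair is in the exceptional configuration. -/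
lemma Far.skew {u v : V} (h : M.Far u v) (hk : 3 ≤ k) {i j : Fin d} (hij : i ≠ j) {s t : Bool}
    {z : V} (hz : M.OnRidge i j s t z) {x y : V} (hx : M.OnFacet i s x) (hy : M.OnFacet i s y)
    (hux : M.zdist u x ≤ M.off i s u) (hvy : M.zdist v y ≤ M.off i s v)
    (hsum : M.off j t x + M.off j t y = k - 1) (hgain : M.off j t x < M.off j t u) :
    k = 3 ∧ M.Skew v u i j s t := by
  have hi := (h.off_add_off i s).1
  have hj := (h.off_add_off j t).1
  have hx0 : M.off i s x = 0 := hx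
  have hy0 : M.off i s y = 0 := hy
  have hS := h.shortcut hij hz (x := x) (by unfold off₂; omega)
  have h1 := hS.short_tight x
  have hxj : M.off j t x = M.off j t u - 1 := by unfold off₂ at h1; omega
  have hyj : M.off j t y = M.off j t v := by omega
  have hyv := hS.other_plane y (by unfold off₂; omega)
  have hxu := hS.short_plane x (by unfold off₂; omega)
  obtain ⟨c, hc, hcu⟩ := hS.short_ridge
  obtain ⟨hoi, hoj⟩ := hS.other_off
  -- otherwise, continuing from `x` inside the facet gives a vertex between `x` and `c`
  have hle : M.off j t u ≤ 2 := by
    by_contra hcon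
    obtain ⟨x', hadj, hlt⟩ := M.exists_adj_lt _
      (((M.isAffine_off i s).const_mul (k + 1)).add (M.isAffine_off j t)) x c (by
        rw [hc.1, hc.2, hx0]; omega)
    rw [hx0] at hlt
    have h2 := M.off_nonneg i s x'
    have h3 := M.off_nonneg j t x'
    have h4 := M.off_le j t x
    have hx'0 : M.off i s x' = 0 := by
      rcases h2.eq_or_lt with h | h
      · exact h.symm
      · nlinarith
    rw [hx'0] at hlt
    have h5 : M.zdist u x' ≤ M.off i s u + 1 := by
      have := M.zdist_triangle u x x'
      rw [M.zdist_of_adj hadj] at this; omega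
    have h6 := hS.short_tight x'
    have hx'j : M.off j t x' = M.off j t x - 1 := by unfold off₂ at h6; omega
    have hx'u := hS.short_plane x' (by unfold off₂; omega)
    refine hadj.ne (M.eq_of_planar_barycenter s t (m₁ := M.off j t x - 1) (m₂ := 1) (m₃ := 0)
      (y₂ := c) (y₃ := c) (hxu.trans hx'u.symm) (hcu.trans hx'u.symm) (hcu.trans hx'u.symm)
      (by omega) (by omega) (by omega) ?_ ?_)
    · rw [hx0, hx'0, hc.1]; ring
    · rw [hx'j, hc.2]; ring
  refine ⟨by omega, hoi, by omega, ⟨y, hy, fun l hl => ?_⟩, ⟨c, hc, hcu⟩⟩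
  by_cases hlj : l = j
  · subst hlj; exact (M.coord_eq_iff_off_eq l t).2 hyj
  · exact hyv l hl hlj

/-- A far pair descends to a facet of the cube parallel to the axis, unless it is in the exceptional
configuration. -/
lemma Far.axial_or_skew {u v : V} (h : M.Far u v) (hk : 3 ≤ k) (i : Fin d) (s : Bool) :
    ((∃ x, M.IsAxialProj i s u x) ∧ (∃ y, M.IsAxialProj i s v y) ∧
      ∀ j, i ≠ j → ∀ t, ∃ z, M.OnRidge i j s t z) ∨
    (k = 3 ∧ ∃ j t, i ≠ j ∧ (M.Skew u v i j s t ∨ M.Skew v u i j s t)) := by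
  obtain ⟨hi, z, hz⟩ := h.off_add_off i s
  obtain ⟨x, hx, hux⟩ := M.exists_descent_facet hz u
  obtain ⟨y, hy, hvy⟩ := M.exists_descent_facet hz v
  have key : ∀ j, i ≠ j → ∀ t, ∃ w, M.OnFacet i s w ∧
      2 * M.off j t w ≤ M.off j t x + M.off j t y - k + 1 := by
    intro j hij t
    obtain ⟨w, hw, hmin⟩ := exists_minimal (M.OnFacet i s) ⟨z, hz⟩ _ (M.off_nonneg j t)
    have h1 := M.zdist_le_in_facet hij hw hmin hx hy
    have h2 := M.zdist_triangle u x v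
    have h3 := M.zdist_triangle x y v
    rw [M.zdist_comm y v] at h3
    have := h.ridge
    exact ⟨w, hw, by omega⟩
  have hridge : ∀ j, i ≠ j → ∀ t, M.off j t x + M.off j t y ≤ k → ∃ w, M.OnRidge i j s t w := by
    intro j hij t hle
    obtain ⟨w, hw, hw'⟩ := key j hij t
    have := M.off_nonneg j t w
    exact ⟨w, hw, by omega⟩
  have hge : ∀ j, i ≠ j → ∀ t, k - 1 ≤ M.off j t x + M.off j t y := by
    intro j hij t
    obtain ⟨w, hw, hw'⟩ := key j hij t
    have := M.off_nonneg j t w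
    omega
  by_cases hall : ∀ j, i ≠ j → ∀ t, M.off j t x + M.off j t y = k
  · left
    have hxu : ∀ j, i ≠ j → ∀ t, M.off j t u ≤ M.off j t x := by
      intro j hij t
      by_contra hcon
      have hj := (h.off_add_off j t).1
      have hxy := hall j hij t
      have hx0 : M.off i s x = 0 := hx
      have hy0 : M.off i s y = 0 := hy
      obtain ⟨w, hw⟩ := hridge j hij t hxy.le
      obtain ⟨w', hw'⟩ := hridge j hij (!t) (hall j hij _).le
      have h1 := (h.shortcut hij hw (x := x) (by unfold off₂; omega)).other_off.1
      have h2 := (h.symm.shortcut hij hw' (x := y) (by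
        unfold off₂; rw [M.off_not, M.off_not]; omega)).other_off.1
      omega
    have hxu' : ∀ j, i ≠ j → M.off j true x = M.off j true u := by
      intro j hij
      have h1 := hxu j hij true
      have h2 := hxu j hij (!true)
      rw [M.off_not, M.off_not] at h2
      omega
    refine ⟨⟨x, hx, fun l hl => (M.coord_eq_iff_off_eq l true).2 (hxu' l hl.symm)⟩,
      ⟨y, hy, fun l hl => (M.coord_eq_iff_off_eq l true).2 ?_⟩,
      fun j hij t => hridge j hij t (hall j hij t).le⟩
    have h1 := hxu' l hl.symm
    have h2 := hall l hl.symm true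
    have h3 := (h.off_add_off l true).1
    omega
  · right
    push Not at hall
    obtain ⟨j, hij, t₀, ht₀⟩ := hall
    obtain ⟨t, ht⟩ : ∃ t, M.off j t x + M.off j t y = k - 1 := by
      have h1 := hge j hij t₀
      have h2 := hge j hij (!t₀)
      rw [M.off_not, M.off_not] at h2
      by_cases h3 : M.off j t₀ x + M.off j t₀ y = k - 1
      · exact ⟨t₀, h3⟩
      · exact ⟨!t₀, by rw [M.off_not, M.off_not]; omega⟩
    obtain ⟨w, hw⟩ := hridge j hij t (by omega)
    have hj := (h.off_add_off j t).1
    by_cases hgain : M.off j t x < M.off j t u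
    · obtain ⟨h3, hS⟩ := h.skew hk hij hw hx hy hux hvy ht hgain
      exact ⟨h3, j, t, hij, .inr hS⟩
    · obtain ⟨h3, hS⟩ := h.symm.skew hk hij hw hy hx hvy hux (by omega) (by omega)
      exact ⟨h3, j, t, hij, .inl hS⟩

/-- For `k = 3`, the vertex at distance one from a facet of the cube moves there parallel to the axis,
in either case of the dichotomy. -/
lemma Far.exists_axialProj {n f : V} (h : M.Far n f) (hk : k = 3) {i : Fin d} {s : Bool}
    (hn : M.off i s n = 1) : ∃ x, M.IsAxialProj i s n x := by
  have hi := (h.off_add_off i s).1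
  rcases h.axial_or_skew hk.ge i s with ⟨hx, -, -⟩ | ⟨-, j, t, -, hS | hS⟩
  · exact hx
  · exact hS.proj
  · have := hS.off_left; omega

/-- The exceptional configuration does not occur when the `i`-th coordinate is not extremal: the
vertices next to `f` in the two directions opposite to the ridge, and the projection of `f` to the
ridge, have `f` in their convex hull. -/
lemma Far.not_skew {n f : V} (h : M.Far n f) (hk : k = 3) {i j : Fin d} (hij : i ≠ j) {s t : Bool}
    (hn : M.off i s n = 1) (hS : M.Skew n f i j s t) : False := by
  have hi := (h.off_add_off i s).1
  have hj := (h.off_add_off j t).1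
  have hjn := hS.off_right
  obtain ⟨x, hx0, hx⟩ := h.symm.exists_axialProj hk (i := i) (s := !s) (by rw [off_not]; omega)
  obtain ⟨y, hy0, hy⟩ := h.symm.exists_axialProj hk (i := j) (s := !t) (by rw [off_not]; omega)
  obtain ⟨c, hc, hcf⟩ := hS.ridge
  unfold OnFacet at hx0 hy0
  rw [off_not] at hx0 hy0
  have hxj := (M.coord_eq_iff_off_eq j t).1 (hx j hij.symm)
  have hyi := (M.coord_eq_iff_off_eq i s).1 (hy i hij)
  have := M.eq_of_planar_barycenter s t (i := i) (j := j) (x := f) (y₁ := x) (y₂ := y) (y₃ := c)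
    (m₁ := 2) (m₂ := 2) (m₃ := 1) (fun l hl _ => hx l hl) (fun l _ hl => hy l hl) hcf (by omega)
    (by omega) (by omega) (by rw [hyi, hc.1]; omega) (by rw [hxj, hc.2]; omega)
  rw [this] at hx0
  omega

/-- There is no far pair. If a coordinate of `u` is not extremal, then `u` lies between its two
projections along that axis. If `u` is a vertex of the cube, then the first vertex on a descent to
the opposite facet lies between `u` and the projection of `u` to a facet or to a ridge. -/
theorem not_far (hk : 3 ≤ k) (hd : 0 < d) (u v : V) : ¬ M.Far u v := by
  intro h
  by_cases hall : ∀ i s, M.off i s u = 0 ∨ M.off i s u = k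
  · obtain ⟨i, s, hs⟩ : ∃ (i : Fin d) (s : Bool), M.off i s u = k := by
      rcases hall ⟨0, hd⟩ true with h0 | h0
      · exact ⟨⟨0, hd⟩, !true, by rw [off_not]; omega⟩
      · exact ⟨_, _, h0⟩
    rcases h.axial_or_skew hk i s with ⟨⟨x, hx⟩, -, hridge⟩ | ⟨h3, j, t, hij, hS | hS⟩
    · have hx0 : M.off i s x = 0 := hx.1
      obtain ⟨w, hadj, hlt⟩ := M.exists_adj_lt _ (M.isAffine_off i s) u x (by omega)
      have hd := M.zdist_of_adj hadj
      have hw := h.facet_tight i s w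
      have hwi : M.off i s w = k - 1 := by omega
      by_cases hline : ∀ l, l ≠ i → M.coord w l = M.coord u l
      · have hwu : M.SamePlane i i w u := fun l hl _ => hline l hl
        refine hadj.ne (M.eq_of_planar_barycenter s s (i := i) (j := i) (m₁ := k - 1) (m₂ := 1)
          (m₃ := 0) (y₂ := x) (y₃ := x) hwu.symm (hx.samePlane.trans hwu.symm)
          (hx.samePlane.trans hwu.symm) (by omega) (by omega) (by omega) ?_ ?_) <;>
        · rw [hs, hwi, hx0]; ring
      · push Not at hline
        obtain ⟨j, hji, hj⟩ := hline
        obtain ⟨t, ht⟩ : ∃ t, M.off j t w < M.off j t u := by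
          rcases lt_or_gt_of_ne hj with h | h
          · exact ⟨false, by simpa [off] using h⟩
          · exact ⟨true, by simpa [off] using h⟩
        obtain ⟨z, hz⟩ := hridge j hji.symm t
        have hwS : M.zdist u w ≤ M.off₂ i j s t u - M.off₂ i j s t w - 1 := by
          unfold off₂; omega
        have hS := h.shortcut hji.symm hz hwS
        obtain ⟨c, hc, hcu⟩ := hS.short_ridge
        have hwu := hS.short_plane w hwS
        have h1 := hS.short_tight w
        have h2 := M.off_nonneg j t w
        have huj : M.off j t u = k := by
          rcases hall j t with h | h
          · omega
          · exact h
        have hwj : M.off j t w = k - 1 := by unfold off₂ at h1; omega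
        refine hadj.ne (M.eq_of_planar_barycenter s t (m₁ := k - 1) (m₂ := 1) (m₃ := 0) (y₂ := c)
          (y₃ := c) hwu.symm (hcu.trans hwu.symm) (hcu.trans hwu.symm) (by omega) (by omega)
          (by omega) ?_ ?_)
        · rw [hs, hwi, hc.1]; ring
        · rw [huj, hwj, hc.2]; ring
    · have := hS.off_right
      have := hall j t
      omega
    · have := hS.off_right
      have := hall j t
      have := (h.off_add_off j t).1
      omega
  · push Not at hall
    obtain ⟨i, s, h0, hk'⟩ := hall
    have hn := M.off_nonneg i s u
    have hl := M.off_le i s u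
    have hi := (h.off_add_off i s).1
    have key : ∀ r, ∃ x, M.IsAxialProj i r u x := by
      intro r
      have hr : 0 < M.off i r u ∧ 0 < M.off i r v := by
        by_cases hrs : r = s
        · subst hrs; omega
        · rw [← Bool.eq_not.2 hrs |>.symm, off_not, off_not]; omega
      rcases h.axial_or_skew hk i r with ⟨hx, -, -⟩ | ⟨h3, j, t, hij, hS | hS⟩
      · exact hx
      · have := hS.off_left
        exact (h.not_skew h3 hij (by omega) hS).elim
      · have := hS.off_left
        exact (h.symm.not_skew h3 hij (by omega) hS).elim
    obtain ⟨x, hx⟩ := key s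
    obtain ⟨y, hy⟩ := key !s
    have hx0 : M.off i s x = 0 := hx.1
    have hy0 : M.off i (!s) y = 0 := hy.1
    rw [off_not] at hy0
    have hyk : M.off i s y = k := by omega
    have := M.eq_of_planar_barycenter s s (i := i) (j := i) (x := u) (y₁ := x) (y₂ := y) (y₃ := y)
      (m₁ := k - M.off i s u) (m₂ := M.off i s u) (m₃ := 0) hx.samePlane hy.samePlane
      hy.samePlane (by omega) (by omega) (by omega) (by rw [hx0, hyk]; ring)
      (by rw [hx0, hyk]; ring)
    rw [this] at hx0
    omega

end VertexModel

/-! ### Edges and extreme sets of polytopes -/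

section Polytope

variable {E : Type*} [NormedAddCommGroup E] [NormedSpace ℝ E]

/-- The theorem of Krein and Milman without closure, for finitely many extreme points. -/
lemma convexHull_extremePoints_of_finite {P : Set E} (hc : IsCompact P) (hP : Convex ℝ P)
    (hfin : (P.extremePoints ℝ).Finite) : convexHull ℝ (P.extremePoints ℝ) = P := by
  rw [← (hfin.isClosed_convexHull ℝ).closure_eq]
  exact closure_convexHull_extremePoints hc hP

/-- A functional attains its maximum over the convex hull of `W` on `W`. -/
lemma exists_mem_lt_of_convexHull {W : Set E} {f : StrongDual ℝ E} {y : E} {c : ℝ}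
    (hy : y ∈ convexHull ℝ W) (h : c < f y) : ∃ w ∈ W, c < f w := by
  by_contra! hcon
  have hsub : convexHull ℝ W ⊆ {z | f z ≤ c} :=
    convexHull_min hcon (convex_halfSpace_le f.toLinearMap.isLinear c)
  exact absurd (hsub hy) (not_le.2 h)

/-- A vertex of a polytope is exposed. -/
lemma exists_strictly_separating {P : Set E} (hP : Convex ℝ P)
    (hfin : (P.extremePoints ℝ).Finite) {x : E} (hx : x ∈ P.extremePoints ℝ) :
    ∃ g : StrongDual ℝ E, ∀ v ∈ P.extremePoints ℝ, v ≠ x → g x < g v := by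
  have hx' : x ∉ convexHull ℝ (P.extremePoints ℝ \ {x}) := fun h =>
    (hP.mem_extremePoints_iff_mem_sdiff_convexHull_sdiff.1 hx).2
      (convexHull_mono (Set.sdiff_subset_sdiff_left extremePoints_subset) h)
  obtain ⟨g, c, h1, h2⟩ := geometric_hahn_banach_point_closed (convex_convexHull ℝ _)
    ((hfin.subset Set.sdiff_subset).isClosed_convexHull ℝ) hx'
  exact ⟨g, fun v hv hvx => h1.trans (h2 v (subset_convexHull ℝ _ ⟨hv, hvx⟩))⟩

/-- A vertex of a polytope at which a functional is not maximal is the end of an edge along which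
the functional increases. The edge corresponds to an extreme point, with maximal value of the
functional, of the vertex figure at that vertex. -/
lemma exists_edge_lt {P : Set E} (hc : IsCompact P) (hP : Convex ℝ P)
    (hfin : (P.extremePoints ℝ).Finite) {x y : E} (hx : x ∈ P.extremePoints ℝ) (hy : y ∈ P)
    {f : StrongDual ℝ E} (hf : f x < f y) :
    ∃ v ∈ P.extremePoints ℝ, f x < f v ∧ IsExtreme ℝ P (segment ℝ x v) := by
  set W := P.extremePoints ℝ with hW
  have hPW : convexHull ℝ W = P := convexHull_extremePoints_of_finite hc hP hfin
  obtain ⟨g, hg⟩ := exists_strictly_separating hP hfin hx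
  obtain ⟨v₀, hv₀, hfv₀⟩ := exists_mem_lt_of_convexHull (hPW.symm ▸ hy) hf
  have hv₀x : v₀ ≠ x := by rintro rfl; exact lt_irrefl _ hfv₀
  -- the vertex figure at `x`
  let D : E → E := fun v => (g v - g x)⁻¹ • (v - x)
  set Q := convexHull ℝ (D '' (W \ {x})) with hQ
  have hDQ : ∀ v ∈ W, v ≠ x → D v ∈ Q := fun v hv hvx =>
    subset_convexHull ℝ _ ⟨v, ⟨hv, hvx⟩, rfl⟩
  have hQc : IsCompact Q := ((hfin.subset Set.sdiff_subset).image D).isCompact_convexHull ℝ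
  have hD : ∀ v ∈ W, v ≠ x → v = x + (g v - g x) • D v := fun v hv hvx => by
    have : g v - g x ≠ 0 := (sub_pos.2 (hg v hv hvx)).ne'
    simp [D, smul_smul, mul_inv_cancel₀ this]
  have hgQ : ∀ q ∈ Q, g q = 1 := by
    have hsub : Q ⊆ {q | g q = 1} := by
      refine convexHull_min ?_ (convex_hyperplane g.toLinearMap.isLinear 1)
      rintro _ ⟨v, ⟨hv, hvx⟩, rfl⟩
      have : g v - g x ≠ 0 := (sub_pos.2 (hg v hv hvx)).ne'
      simp [D, inv_mul_cancel₀ this]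
    exact hsub
  -- every point of `P` lies in the cone over the vertex figure
  have hcone : ∀ z ∈ P, ∃ α : ℝ, 0 ≤ α ∧ ∃ q ∈ Q, z = x + α • q := by
    have hsub : convexHull ℝ W ⊆ {z | ∃ α : ℝ, 0 ≤ α ∧ ∃ q ∈ Q, z = x + α • q} := by
      refine convexHull_min ?_ ?_
      · intro v hv
        by_cases hvx : v = x
        · exact ⟨0, le_rfl, D v₀, hDQ v₀ hv₀ hv₀x, by simp [hvx]⟩
        · exact ⟨g v - g x, (sub_pos.2 (hg v hv hvx)).le, D v, hDQ v hv hvx, hD v hv hvx⟩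
      · rintro _ ⟨α, hα, q, hq, rfl⟩ _ ⟨β, hβ, r, hr, rfl⟩ a b ha hb hab
        have hsum : a • (x + α • q) + b • (x + β • r) = x + ((a * α) • q + (b * β) • r) := by
          rw [smul_add, smul_add, smul_smul, smul_smul]
          nth_rw 3 [← one_smul ℝ x]
          rw [← hab, add_smul]; abel
        rw [hsum]
        rcases (add_nonneg (mul_nonneg ha hα) (mul_nonneg hb hβ)).eq_or_lt with h0 | h0
        · have h1 : a * α = 0 := by nlinarith [mul_nonneg ha hα, mul_nonneg hb hβ]
          have h2 : b * β = 0 := by nlinarith [mul_nonneg ha hα, mul_nonneg hb hβ]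
          exact ⟨0, le_rfl, q, hq, by simp [h1, h2]⟩
        · refine ⟨a * α + b * β, h0.le, (a * α / (a * α + b * β)) • q
            + (b * β / (a * α + b * β)) • r, convex_convexHull ℝ _ hq hr (by positivity)
            (by positivity) (by field_simp), ?_⟩
          rw [smul_add, smul_smul, smul_smul, mul_div_cancel₀ _ h0.ne', mul_div_cancel₀ _ h0.ne']
    rw [hPW] at hsub
    exact hsub
  -- an extreme point of the vertex figure that maximizes `f`
  have hexp : IsExposed ℝ Q (f.toExposed Q) := ContinuousLinearMap.toExposed.isExposed
  obtain ⟨q₀, hq₀, hmax⟩ := hQc.exists_isMaxOn ⟨_, hDQ v₀ hv₀ hv₀x⟩ f.continuous.continuousOn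
  obtain ⟨q, hq⟩ := (hexp.isCompact hQc).extremePoints_nonempty ⟨q₀, hq₀, hmax⟩
  have hqQ : q ∈ Q.extremePoints ℝ := hexp.isExtreme.extremePoints_subset_extremePoints hq
  obtain ⟨v, ⟨hv, hvx⟩, hvq⟩ := extremePoints_convexHull_subset hqQ
  have ht : 0 < g v - g x := sub_pos.2 (hg v hv hvx)
  have hvq' : v = x + (g v - g x) • q := hvq ▸ hD v hv hvx
  set t := g v - g x with htdef
  have hfq : 0 < f q := by
    have h1 := hq.1.2 _ (hDQ v₀ hv₀ hv₀x)
    have h2 : 0 < f (D v₀) := by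
      simp only [D, map_smul, map_sub, smul_eq_mul]
      exact mul_pos (inv_pos.2 (sub_pos.2 (hg v₀ hv₀ hv₀x))) (sub_pos.2 hfv₀)
    exact h2.trans_le h1
  have hvP : v ∈ P := hv.1
  refine ⟨v, hv, ?_, hP.segment_subset hx.1 hvP, ?_⟩
  · rw [hvq', map_add, map_smul, smul_eq_mul]
    have := mul_pos ht hfq
    linarith
  · intro y hy z hz w hw hwyz
    obtain ⟨α, hα, p, hp, rfl⟩ := hcone y hy
    obtain ⟨β, hβ, r, hr, rfl⟩ := hcone z hz
    obtain ⟨a, b, ha, hb, hab, rfl⟩ := hwyz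
    rw [segment_eq_image'] at hw
    obtain ⟨c, ⟨hc0, hc1⟩, hcw⟩ := hw
    have hvx' : v - x = t • q := by rw [hvq']; abel
    have hsum : a • (x + α • p) + b • (x + β • r) = x + ((a * α) • p + (b * β) • r) := by
      rw [smul_add, smul_add, smul_smul, smul_smul]
      nth_rw 3 [← one_smul ℝ x]
      rw [← hab, add_smul]; abel
    simp only [hsum, hvx', smul_smul, add_right_inj] at hcw
    rcases hα.eq_or_lt with rfl | hα
    · rw [zero_smul, add_zero]; exact left_mem_segment ℝ x v
    have hgc : c * t = a * α + b * β := by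
      have := congrArg g hcw
      simpa [hgQ p hp, hgQ r hr, hgQ q hqQ.1] using this
    have haα := mul_pos ha hα
    have hbβ := mul_nonneg hb.le hβ
    have hct : 0 < c * t := by linarith
    have hpq : p = q := by
      rcases hbβ.eq_or_lt with h0 | h0
      · rw [← h0, add_zero] at hgc
        rw [← h0, zero_smul, add_zero, hgc] at hcw
        exact (smul_right_injective E haα.ne' hcw).symm
      · refine hqQ.2 hp hr ⟨a * α / (c * t), b * β / (c * t), by positivity, by positivity, ?_, ?_⟩
        · rw [← add_div, ← hgc, div_self hct.ne']
        · rw [div_eq_inv_mul, div_eq_inv_mul, mul_smul _ (a * α), mul_smul _ (b * β), ← smul_add,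
            ← hcw, smul_smul, inv_mul_cancel₀ hct.ne', one_smul]
    subst hpq
    have hαt : α ≤ t := by
      by_contra! hlt
      refine hvx (hv.2 hx.1 hy ⟨1 - t / α, t / α, ?_, by positivity, by ring, ?_⟩).symm
      · rw [sub_pos, div_lt_one hα]; exact hlt
      · rw [hvq', smul_add, smul_smul, div_mul_cancel₀ _ hα.ne', ← add_assoc, ← add_smul,
          sub_add_cancel, one_smul]
    rw [segment_eq_image']
    refine ⟨α / t, ⟨by positivity, (div_le_one ht).2 hαt⟩, ?_⟩
    simp only [hvx', smul_smul, div_mul_cancel₀ _ ht.ne']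

/-- If a point of an extreme set is a barycenter of three points, then the points with positive weight
belong to the extreme set. -/
lemma IsExtreme.mem_of_barycenter {P B : Set E} (hP : Convex ℝ P) (hB : IsExtreme ℝ P B)
    {w y₁ y₂ y₃ : E} (hw : w ∈ B) (h₁ : y₁ ∈ P) (h₂ : y₂ ∈ P) (h₃ : y₃ ∈ P) {m₁ m₂ m₃ : ℝ}
    (hm₁ : 0 < m₁) (hm₂ : 0 ≤ m₂) (hm₃ : 0 ≤ m₃)
    (h : m₁ • (y₁ - w) + m₂ • (y₂ - w) + m₃ • (y₃ - w) = 0) : y₁ ∈ B := by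
  rcases (add_nonneg hm₂ hm₃).eq_or_lt with h0 | h0
  · have e2 : m₂ = 0 := by linarith
    have e3 : m₃ = 0 := by linarith
    rw [e2, e3, zero_smul, zero_smul, add_zero, add_zero, smul_eq_zero, sub_eq_zero] at h
    rcases h with h | h
    · exact absurd h hm₁.ne'
    · rwa [h]
  · have hz : (m₂ / (m₂ + m₃)) • y₂ + (m₃ / (m₂ + m₃)) • y₃ ∈ P :=
      hP h₂ h₃ (by positivity) (by positivity) (by field_simp)
    refine hB.left_mem_of_mem_openSegment h₁ hz hw
      ⟨m₁ / (m₁ + (m₂ + m₃)), (m₂ + m₃) / (m₁ + (m₂ + m₃)), by positivity, by positivity,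
        by field_simp, ?_⟩
    have hs : m₁ + (m₂ + m₃) ≠ 0 := by positivity
    have key : m₁ • y₁ + (m₂ • y₂ + m₃ • y₃) = (m₁ + (m₂ + m₃)) • w := by
      rw [← sub_eq_zero, ← h]; module
    rw [smul_add, smul_smul, smul_smul, div_mul_div_comm, div_mul_div_comm,
      mul_comm (m₁ + (m₂ + m₃)), mul_div_mul_left _ _ h0.ne', mul_div_mul_left _ _ h0.ne', div_eq_inv_mul, div_eq_inv_mul, div_eq_inv_mul, mul_smul,
      mul_smul, mul_smul, ← smul_add, ← smul_add, key, smul_smul, inv_mul_cancel₀ hs, one_smul]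

end Polytope

section Image

variable {E F : Type*} [AddCommGroup E] [Module ℝ E] [AddCommGroup F] [Module ℝ F]

lemma isExtreme_image_iff {A B : Set E} (hA : Convex ℝ A) (hBA : B ⊆ A) (f : E →ₗ[ℝ] F)
    (hf : Set.InjOn f A) : IsExtreme ℝ (f '' A) (f '' B) ↔ IsExtreme ℝ A B := by
  constructor
  · refine fun h => ⟨hBA, fun y hy z hz w hw hwyz => ?_⟩
    have hmem : f w ∈ openSegment ℝ (f y) (f z) := by
      rw [← f.coe_toAffineMap, ← image_openSegment]
      exact ⟨w, hwyz, rfl⟩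
    obtain ⟨y', hy', hyy'⟩ := h.left_mem_of_mem_openSegment ⟨y, hy, rfl⟩ ⟨z, hz, rfl⟩ ⟨w, hw, rfl⟩
      hmem
    rwa [← hf (hBA hy') hy hyy']
  · refine fun h => ⟨Set.image_mono hBA, ?_⟩
    rintro _ ⟨y, hy, rfl⟩ _ ⟨z, hz, rfl⟩ _ ⟨w, hw, rfl⟩ hmem
    rw [← f.coe_toAffineMap, ← image_openSegment] at hmem
    obtain ⟨w', hw', hww'⟩ := hmem
    have : w' = w := hf (hA.openSegment_subset hy hz hw') (hBA hw) hww'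
    subst this
    exact ⟨y, h.left_mem_of_mem_openSegment hy hz hw hw', rfl⟩

lemma extremePoints_image_eq {A : Set E} (hA : Convex ℝ A) (f : E →ₗ[ℝ] F) (hf : Set.InjOn f A) :
    (f '' A).extremePoints ℝ = f '' A.extremePoints ℝ := by
  have key : ∀ x ∈ A, f x ∈ (f '' A).extremePoints ℝ ↔ x ∈ A.extremePoints ℝ := fun x hx => by
    rw [← isExtreme_singleton, ← isExtreme_singleton, ← Set.image_singleton,
      isExtreme_image_iff hA (Set.singleton_subset_iff.2 hx) f hf]
  ext y
  constructor
  · intro hy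
    obtain ⟨x, hx, rfl⟩ := hy.1
    exact ⟨x, (key x hx).1 hy, rfl⟩
  · rintro ⟨x, hx, rfl⟩
    exact (key x hx.1).2 hx

end Image

/-! ### Graphs of lattice polytopes -/

section Lattice

variable {d k : ℕ} {P : Set (Fin d → ℝ)}

lemma IsLatticePolytope.isCompact (h : IsLatticePolytope P) : IsCompact P := by
  obtain ⟨S, hS, -, -, rfl⟩ := h
  exact hS.isCompact_convexHull ℝ

lemma IsLatticePolytope.convex (h : IsLatticePolytope P) : Convex ℝ P := by
  obtain ⟨S, -, -, -, rfl⟩ := h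
  exact convex_convexHull ℝ S

lemma IsLatticePolytope.finite_vertices (h : IsLatticePolytope P) :
    (P.extremePoints ℝ).Finite := by
  obtain ⟨S, hS, -, -, rfl⟩ := h
  exact hS.subset extremePoints_convexHull_subset

lemma IsLatticePolytope.nonempty_vertices (h : IsLatticePolytope P) :
    (P.extremePoints ℝ).Nonempty := by
  refine h.isCompact.extremePoints_nonempty ?_
  obtain ⟨S, -, hS, -, rfl⟩ := h
  exact hS.convexHull

lemma IsLatticePolytope.exists_adj_lt (h : IsLatticePolytope P) (x : polytopeVertices P)
    {y : Fin d → ℝ} (hy : y ∈ P) {f : StrongDual ℝ (Fin d → ℝ)} (hf : f x < f y) :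
    ∃ v, (polytopeGraph P).Adj x v ∧ f x < f v := by
  obtain ⟨v, hv, hlt, hE⟩ := exists_edge_lt h.isCompact h.convex h.finite_vertices x.2 hy hf
  refine ⟨⟨v, hv⟩, ⟨?_, hE⟩, hlt⟩
  rintro rfl
  exact lt_irrefl _ hlt

/-- A vertex on which a functional is minimal, among those that can be reached from `u`, must be `v`
if the functional exposes `v`. -/
lemma IsLatticePolytope.connected (h : IsLatticePolytope P) : (polytopeGraph P).Connected := by
  have hfin : Finite (polytopeVertices P) := h.finite_vertices
  obtain ⟨v₀, hv₀⟩ := h.nonempty_vertices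
  have : Nonempty (polytopeVertices P) := ⟨⟨v₀, hv₀⟩⟩
  refine SimpleGraph.Connected.mk fun u v => ?_
  obtain ⟨g, hg⟩ := exists_strictly_separating h.convex h.finite_vertices v.2
  obtain ⟨x, hx, hmin⟩ := Set.exists_min_image {x | (polytopeGraph P).Reachable u x}
    (fun x => g x) (Set.toFinite _) ⟨u, SimpleGraph.Reachable.refl u⟩
  by_cases hxv : x = v
  · exact hxv ▸ hx
  · have hlt : (-g) x < (-g) v := by
      simpa using hg x x.2 fun h => hxv (Subtype.ext h)
    obtain ⟨y, hadj, hy⟩ := h.exists_adj_lt x v.2.1 hlt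
    exact absurd (hmin y (hx.trans hadj.reachable)) (by simpa using hy)

/-- The number of vertices, and hence the diameter, is at most the number of lattice points of the
cube. -/
lemma IsLatticeDKPolytope.diam_le (h : IsLatticeDKPolytope d k P) :
    (polytopeGraph P).diam ≤ (k + 1) ^ d := by
  have hfin : Finite (polytopeVertices P) := h.1.finite_vertices
  have := Fintype.ofFinite (polytopeVertices P)
  have hconn := h.1.connected
  have := hconn.nonempty
  obtain ⟨u, v, huv⟩ := (polytopeGraph P).exists_dist_eq_diam
  obtain ⟨p, hp, hlen⟩ := (hconn u v).exists_path_of_dist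
  have hlt := hp.length_lt
  choose m hm using fun (x : polytopeVertices P) i => h.2 x x.2 i
  have hinj : Function.Injective
      (fun (x : polytopeVertices P) (i : Fin d) =>
        (⟨m x i, Nat.lt_succ_of_le (hm x i).1⟩ : Fin (k + 1))) := by
    intro x y hxy
    refine Subtype.ext (funext fun i => ?_)
    have := congrArg Fin.val (congrFun hxy i)
    simp only at this
    rw [(hm x i).2, (hm y i).2, this]
  have hcard := Fintype.card_le_of_injective _ hinj
  simp only [Fintype.card_pi, Fintype.card_fin, Finset.prod_const, Finset.card_univ] at hcard
  omega

lemma IsLatticeDKPolytope.dist_le (h : IsLatticeDKPolytope d k P) (u v : polytopeVertices P) :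
    (polytopeGraph P).dist u v ≤ maxLatticeDiameter d k := by
  have hfin : Finite (polytopeVertices P) := h.1.finite_vertices
  have : Nonempty (polytopeVertices P) := ⟨u⟩
  refine (SimpleGraph.dist_le_diam (SimpleGraph.connected_iff_ediam_ne_top.1 h.1.connected)).trans
    (le_csSup ⟨(k + 1) ^ d, ?_⟩ ⟨P, h, rfl⟩)
  rintro _ ⟨P', h', rfl⟩
  exact h'.diam_le

/-- A face on which the coordinates in `T` are constant projects isomorphically to a lattice
`(d - |T|, k)`-polytope, by omitting these coordinates. -/
lemma IsLatticeDKPolytope.dist_le_of_face (h : IsLatticeDKPolytope d k P)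
    (f : StrongDual ℝ (Fin d → ℝ)) (T : Finset (Fin d)) (x y : polytopeVertices P)
    (hx : ∀ z ∈ P, f z ≤ f x) (hy : f y = f x)
    (hT : ∀ z : polytopeVertices P, f z = f x → ∀ t ∈ T, z.1 t = x.1 t) :
    (polytopeGraph P).dist x y ≤ maxLatticeDiameter (d - T.card) k := by
  set F := f.toExposed P with hF
  have hexp : IsExposed ℝ P F := ContinuousLinearMap.toExposed.isExposed
  have hext := hexp.isExtreme
  have hFc := hexp.isCompact h.1.isCompact
  have hFconv := hexp.convex h.1.convex
  have hvert : F.extremePoints ℝ ⊆ P.extremePoints ℝ := hext.extremePoints_subset_extremePoints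
  have hFfin := h.1.finite_vertices.subset hvert
  have hhull := convexHull_extremePoints_of_finite hFc hFconv hFfin
  have hxF : x.1 ∈ F := ⟨x.2.1, hx⟩
  have hyF : y.1 ∈ F := ⟨y.2.1, fun z hz => hy ▸ hx z hz⟩
  have hFf : ∀ z ∈ F, f z = f x := fun z hz => le_antisymm (hx z hz.1) (hz.2 x x.2.1)
  -- the coordinates in `T` are constant on the face
  have hFT : ∀ z ∈ F, ∀ t ∈ T, z t = x.1 t := by
    intro z hz t ht
    have hsub : convexHull ℝ (F.extremePoints ℝ) ⊆ {z | z t = x.1 t} :=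
      convexHull_min (fun w hw => hT ⟨w, hvert hw⟩ (hFf w hw.1) t ht)
        (convex_hyperplane (f := fun z : Fin d → ℝ => z t)
          (LinearMap.proj (R := ℝ) (φ := fun _ : Fin d => ℝ) t).isLinear _)
    rw [hhull] at hsub
    exact hsub hz
  have hcard : Tᶜ.card = d - T.card := by rw [Finset.card_compl, Fintype.card_fin]
  let e := Tᶜ.orderEmbOfFin hcard
  let π : (Fin d → ℝ) →ₗ[ℝ] (Fin (d - T.card) → ℝ) := LinearMap.funLeft ℝ ℝ e
  have hπ : ∀ z i, π z i = z (e i) := fun z i => rfl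
  have hinj : Set.InjOn π F := by
    intro z hz w hw hzw
    funext i
    by_cases hi : i ∈ T
    · rw [hFT z hz i hi, hFT w hw i hi]
    · have : i ∈ Set.range e := by
        rw [Finset.range_orderEmbOfFin]; simpa using hi
      obtain ⟨j, rfl⟩ := this
      exact congrFun hzw j
  have hextπ : (π '' F).extremePoints ℝ = π '' F.extremePoints ℝ :=
    extremePoints_image_eq hFconv π hinj
  have hgrid : ∀ p ∈ (π '' F).extremePoints ℝ, ∀ i, ∃ m : ℕ, m ≤ k ∧ p i = m := by
    rw [hextπ]
    rintro _ ⟨z, hz, rfl⟩ i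
    exact h.2 z (hvert hz) (e i)
  have hQ : IsLatticeDKPolytope (d - T.card) k (π '' F) := by
    refine ⟨⟨π '' F.extremePoints ℝ, hFfin.image _,
      (hFc.extremePoints_nonempty ⟨x, hxF⟩).image _, fun p hp i => ?_, ?_⟩, hgrid⟩
    · rw [← hextπ] at hp
      obtain ⟨m, -, hm⟩ := hgrid p hp i
      exact ⟨m, by simpa using hm⟩
    · rw [← LinearMap.image_convexHull, hhull]
  have hlift : ∀ p : polytopeVertices (π '' F), ∃ q ∈ F.extremePoints ℝ, π q = p := fun p => by
    have hp : p.1 ∈ (π '' F).extremePoints ℝ := p.2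
    rwa [hextπ] at hp
  choose q hq hqp using hlift
  let φ : polytopeGraph (π '' F) →g polytopeGraph P :=
    { toFun := fun p => ⟨q p, hvert (hq p)⟩
      map_rel' := by
        rintro p p' ⟨hne, hE⟩
        refine ⟨fun heq => hne (Subtype.ext ?_), hext.trans ?_⟩
        · rw [← hqp p, ← hqp p', Subtype.mk.inj heq]
        · rw [← hqp p, ← hqp p', ← π.coe_toAffineMap, ← image_segment, π.coe_toAffineMap,
            isExtreme_image_iff hFconv (hFconv.segment_subset (hq p).1 (hq p').1) π hinj] at hE
          exact hE }
  have hφ : ∀ w : polytopeVertices P, w.1 ∈ F → ∃ p, φ p = w := by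
    intro w hw
    have hwF : w.1 ∈ F.extremePoints ℝ := hext.extremePoints_eq ▸ ⟨hw, w.2⟩
    have hp : π w ∈ (π '' F).extremePoints ℝ := hextπ ▸ ⟨w, hwF, rfl⟩
    exact ⟨⟨π w, hp⟩, Subtype.ext (hinj (hq _).1 hw (hqp _))⟩
  obtain ⟨a, rfl⟩ := hφ x hxF
  obtain ⟨b, rfl⟩ := hφ y hyF
  obtain ⟨w, hw⟩ := hQ.1.connected.exists_walk_length_eq_dist a b
  calc (polytopeGraph P).dist (φ a) (φ b) ≤ (w.map φ).length := SimpleGraph.dist_le _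
    _ = (polytopeGraph (π '' F)).dist a b := by rw [SimpleGraph.Walk.length_map, hw]
    _ ≤ maxLatticeDiameter (d - T.card) k := hQ.dist_le a b

/-- A lattice `(d,k)`-polytope as a `VertexModel`. The coordinates of its vertices are natural
numbers, so that taking the floor does not change them. -/
noncomputable def IsLatticeDKPolytope.vertexModel (h : IsLatticeDKPolytope d k P) :
    VertexModel d k (fun t => maxLatticeDiameter (d - t) k) (polytopeVertices P) :=
  have hcoord : ∀ (x : polytopeVertices P) i, ((⌊x.1 i⌋ : ℤ) : ℝ) = x.1 i := fun x i => by
    obtain ⟨m, -, hm⟩ := h.2 x x.2 i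
    rw [hm, Int.floor_natCast, Int.cast_natCast]
  have hdual : ∀ g : polytopeVertices P → ℤ,
      IsAffineInCoords (fun x i => ⌊x.1 i⌋) g →
      ∃ (f : StrongDual ℝ (Fin d → ℝ)) (b : ℝ), ∀ x, (g x : ℝ) = b - f x := by
    rintro g ⟨c, b, hg⟩
    refine ⟨-∑ i, (c i : ℝ) • ContinuousLinearMap.proj (R := ℝ) (φ := fun _ : Fin d => ℝ) i, b,
      fun x => ?_⟩
    rw [hg x]
    push_cast
    simp only [hcoord]
    simp
  { graph := polytopeGraph P
    connected := h.1.connected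
    coord := fun x i => ⌊x.1 i⌋
    coord_nonneg := fun x i => by
      obtain ⟨m, -, hm⟩ := h.2 x x.2 i
      simp [hm]
    coord_le := fun x i => by
      obtain ⟨m, hmk, hm⟩ := h.2 x x.2 i
      simpa [hm] using hmk
    exists_adj_lt := by
      intro g hg x y hlt
      obtain ⟨f, b, hf⟩ := hdual g hg
      have hlt' : f x < f y := by
        have : (g y : ℝ) < g x := by exact_mod_cast hlt
        rw [hf, hf] at this; linarith
      obtain ⟨z, hadj, hz⟩ := h.1.exists_adj_lt x y.2.1 hlt'
      refine ⟨z, hadj, ?_⟩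
      have : (g z : ℝ) < g x := by rw [hf, hf]; linarith
      exact_mod_cast this
    dist_le_of_face := by
      intro g hg T x y hx hy hT
      obtain ⟨f, b, hf⟩ := hdual g hg
      have hfg : ∀ z w : polytopeVertices P, f z ≤ f w ↔ g w ≤ g z := fun z w => by
        rw [← @Int.cast_le ℝ, hf, hf]; constructor <;> intro <;> linarith
      have hfg' : ∀ z w : polytopeVertices P, f z = f w → g z = g w := fun z w h =>
        le_antisymm ((hfg w z).1 h.ge) ((hfg z w).1 h.le)
      have := h.dist_le_of_face f T x y (fun z hz => by
          by_contra! hlt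
          have hhull := convexHull_extremePoints_of_finite h.1.isCompact h.1.convex
            h.1.finite_vertices
          obtain ⟨w, hw, hlt'⟩ := exists_mem_lt_of_convexHull (hhull.symm ▸ hz) hlt
          exact absurd ((hfg ⟨w, hw⟩ x).2 (hx ⟨w, hw⟩)) (not_le.2 hlt'))
        (le_antisymm ((hfg y x).2 hy.ge) ((hfg x y).2 hy.le))
        (fun z hz t ht => by
          have := hT z (hfg' z x hz) t ht
          rw [← hcoord z t, ← hcoord x t, this])
      exact_mod_cast this
    eq_of_barycenter := by
      intro x y₁ y₂ y₃ m₁ m₂ m₃ hm₁ hm₂ hm₃ hsum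
      refine Subtype.ext ((isExtreme_singleton.2 x.2).mem_of_barycenter h.1.convex
        (Set.mem_singleton _) y₁.2.1 y₂.2.1 y₃.2.1 (m₁ := m₁) (m₂ := m₂) (m₃ := m₃)
        (by exact_mod_cast hm₁) (by exact_mod_cast hm₂) (by exact_mod_cast hm₃) ?_)
      funext i
      have := congrArg (Int.cast : ℤ → ℝ) (hsum i)
      push_cast at this
      simp only [hcoord] at this
      simpa using this
    eq_of_crossing := by
      intro x x' y z n₁ n₂ m₁ m₂ hadj hn₁ hn₂ hm₁ hm₂ hmn hsum
      have hm₁' : (0 : ℝ) < m₁ := by exact_mod_cast hm₁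
      have hm₂' : (0 : ℝ) < m₂ := by exact_mod_cast hm₂
      have hn₁' : (0 : ℝ) ≤ n₁ := by exact_mod_cast hn₁
      have hn₂' : (0 : ℝ) ≤ n₂ := by exact_mod_cast hn₂
      have hmn' : (m₁ : ℝ) + m₂ = n₁ + n₂ := by exact_mod_cast hmn
      have hN : (n₁ : ℝ) + n₂ ≠ 0 := by rw [← hmn']; positivity
      have hmem : (n₁ / (n₁ + n₂) : ℝ) • x.1 + (n₂ / (n₁ + n₂) : ℝ) • x'.1 ∈ segment ℝ x.1 x'.1 :=
        ⟨_, _, by positivity, by positivity, by field_simp, rfl⟩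
      have hy := hadj.2.mem_of_barycenter h.1.convex hmem y.2.1 z.2.1 z.2.1 hm₁' hm₂'.le le_rfl (by
        funext i
        have := congrArg (Int.cast : ℤ → ℝ) (hsum i)
        push_cast at this
        simp only [hcoord] at this
        simp only [Pi.add_apply, Pi.smul_apply, Pi.sub_apply, smul_eq_mul, Pi.zero_apply, zero_mul,
          add_zero]
        field_simp
        linear_combination (n₁ + n₂ : ℝ) * this - (n₁ * x.1 i + n₂ * x'.1 i) * hmn')
      rcases (mem_extremePoints_iff_forall_segment.1 y.2).2 x x.2.1 x' x'.2.1 hy with h | h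
      · exact .inl (Subtype.ext h.symm)
      · exact .inr (Subtype.ext h.symm) }

end Lattice

theorem theorem3 (d k : ℕ) (hd : 3 ≤ d) (hk : 3 ≤ k) (P : Set (Fin d → ℝ))
    (hP : IsLatticeDKPolytope d k P) (u v : polytopeVertices P) :
    (polytopeGraph P).Reachable u v ∧
      ((polytopeGraph P).dist u v ≤ maxLatticeDiameter (d - 1) k + (k - 1) ∨
        (polytopeGraph P).dist u v ≤ maxLatticeDiameter (d - 2) k + (2 * k - 2) ∨
        (polytopeGraph P).dist u v ≤ maxLatticeDiameter (d - 3) k + (3 * k - 2)) := by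
  refine ⟨hP.1.connected u v, ?_⟩
  by_contra! hcon
  obtain ⟨h1, h2, h3⟩ := hcon
  have hdist : hP.vertexModel.zdist u v = ((polytopeGraph P).dist u v : ℤ) := rfl
  exact VertexModel.not_far (by omega) (by omega) u v (M := hP.vertexModel)
    ⟨by rw [hdist]; omega, by rw [hdist]; omega, by rw [hdist]; omega⟩
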